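/- All operators below are bounded self-adjoint operators on complex Hilbert spaces. For a continuous function $f:\mathbb R\to\mathbb C$ and $\delta>0$ let $$\Omega_f(\delta)=\sup\{\|f(A)-f(B)\| : A=A^*,\ B=B^*,\ \|A-B\|<\delta\}\in[0,\infty],$$ and for a continuous function $f:E\to\mathbb C$ on a closed set $E\subset\mathbb R$ let $$\Omega_{f,E}(\delta)=\sup\{\|f(A)-f(B)\| : A=A^*,\ B=B^*,\ \sigma(A)\subset E,\ \sigma(B)\subset E,\ \|A-B\|<\delta\}\in[0,\infty],$$ where $f(A)$ is given by the continuous functional calculus and $\sigma(A)$ is the spectrum of $A$. (1) If $f:\mathbb R\to\mathbb C$ is continuous and $\Omega_f(\delta)<\infty$ for all $\delta>0$, then the limit $\lim_{|t|\to\infty}t^{-1}f(t)$ exists and is finite. (2) If $E\subset\mathbb R$ is an unbounded closed set, $f:E\to\mathbb C$ is continuous, and $\Omega_{f,E}(\delta)<\infty$ for all $\delta>0$, then the function $t\mapsto t^{-1}f(t)$ has a finite limit as $|t|\to\infty$, $t\in E$. -/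

import Mathlib

open Filter Topology
open scoped ENNReal

universe u

noncomputable section

/-- `f(A)` for a bounded self-adjoint operator `A` on a complex Hilbert space and a function
`f : ℝ → ℂ`: the continuous functional calculus of the normal operator `A`. The spectrum of `A` is
real, so `z ↦ f (re z)` restricts to `f` on it. -/
def applyFun {H : Type u} [NormedAddCommGroup H] [InnerProductSpace ℂ H] [CompleteSpace H]
    (f : ℝ → ℂ) (A : H →L[ℂ] H) : H →L[ℂ] H :=
  cfc (fun z : ℂ => f z.re) A

/-- The operator modulus of continuity `Ω_f(δ)`: the supremum in `[0, ∞]` of `‖f(A) - f(B)‖` over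
all bounded self-adjoint operators `A`, `B` on a complex Hilbert space with `‖A - B‖ < δ`. -/
def operatorModulus (f : ℝ → ℂ) (δ : ℝ) : ℝ≥0∞ :=
  sSup {r : ℝ≥0∞ | ∃ (H : Type u) (_ : NormedAddCommGroup H) (_ : InnerProductSpace ℂ H)
    (_ : CompleteSpace H) (A B : H →L[ℂ] H),
      IsSelfAdjoint A ∧ IsSelfAdjoint B ∧ ‖A - B‖ < δ ∧
      r = ENNReal.ofReal ‖applyFun f A - applyFun f B‖}

/-- The operator modulus of continuity `Ω_{f,E}(δ)`: as `Ω_f(δ)`, but only operators `A`, `B` whose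
spectra are contained in `E ⊆ ℝ` are admitted. It depends only on the values of `f` on `E`. -/
def operatorModulusOn (E : Set ℝ) (f : ℝ → ℂ) (δ : ℝ) : ℝ≥0∞ :=
  sSup {r : ℝ≥0∞ | ∃ (H : Type u) (_ : NormedAddCommGroup H) (_ : InnerProductSpace ℂ H)
    (_ : CompleteSpace H) (A B : H →L[ℂ] H),
      IsSelfAdjoint A ∧ IsSelfAdjoint B ∧
      spectrum ℂ A ⊆ Complex.ofReal '' E ∧ spectrum ℂ B ⊆ Complex.ofReal '' E ∧
      ‖A - B‖ < δ ∧
      r = ENNReal.ofReal ‖applyFun f A - applyFun f B‖}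

end

/-! Finiteness of the modulus at `δ = 1` gives a commutator estimate: the Cayley transform `U` of a
small self-adjoint `R` almost commutes with `A` when `R` does, and `f(UAU*) = U f(A) U*`, so `[f(A),
R]` is bounded by the modulus (`norm_commutator_applyFun_le`). For a diagonal `A` and an
off-diagonal block `R`, this says that Schur multiplication by the divided differences of `f` is
bounded, provided the nodes are far apart (`norm_dividedDiff_schur_le`).

A 1×1 block shows that `f(t)/t` is bounded near infinity. If it had limit points `α ≠ β`, nodes
chosen alternately near the two regimes would have divided differences close to `α` strictly below
the diagonal and to `β` elsewhere (`exists_seq_pairs_dividedDiff`). Triangular truncation would then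
be bounded uniformly in the matrix size, which `exists_matrix_large_triangular_part` excludes. A
bounded function with a single limit point converges. -/

/-! ### Cayley transform and commutators -/

section Cayley
variable {𝒜 : Type*} [CStarAlgebra 𝒜]

/-- The Cayley transform of a small self-adjoint element `R` is a unitary whose commutators are comparable
with those of `R`. -/
theorem exists_unitary_commutator_bounds [Nontrivial 𝒜] {R : 𝒜} (hR : IsSelfAdjoint R) (hn : ‖R‖ ≤ 1 / 2) :
    ∃ U ∈ unitary 𝒜, ∀ T : 𝒜, ‖T * U - U * T‖ ≤ 8 * ‖T * R - R * T‖ ∧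
      ‖T * R - R * T‖ ≤ 2 * ‖T * U - U * T‖ := by
  have hI : ‖Complex.I • R‖ ≤ 1 / 2 := by rw [norm_smul]; simpa using hn
  -- With `G = (1 - iR)⁻¹`, the unitary is `2G - 1 = (1 + iR)(1 - iR)⁻¹`.
  set X : 𝒜ˣ := Units.oneSub (Complex.I • R) (lt_of_le_of_lt hI (by norm_num)) with hX
  have hXv : (X : 𝒜) = 1 - Complex.I • R := by simp [hX]
  set G : 𝒜 := ((X⁻¹ : 𝒜ˣ) : 𝒜) with hG
  have hGX : G * (X : 𝒜) = 1 := by simp [hG]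
  have hXG : (X : 𝒜) * G = 1 := by simp [hG]
  have hXG' : (1 - Complex.I • R) * G = 1 := by rw [← hXv, hXG]
  have hsX : star (X : 𝒜) = 2 - X := by
    rw [hXv, star_sub, star_smul, hR.star_eq, star_one, ← starRingEnd_apply, Complex.conj_I, neg_smul,
      ← one_add_one_eq_two]
    abel
  have hGn : ‖G‖ ≤ 2 := by
    have h1 : G = 1 + (Complex.I • R) * G := by
      rw [sub_mul, one_mul] at hXG'
      rw [← hXG']; abel
    have h2 : ‖G‖ ≤ 1 + 1 / 2 * ‖G‖ := by
      calc ‖G‖ = ‖1 + (Complex.I • R) * G‖ := by rw [← h1]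
        _ ≤ ‖(1 : 𝒜)‖ + ‖Complex.I • R‖ * ‖G‖ := (norm_add_le _ _).trans (by gcongr; exact norm_mul_le _ _)
        _ ≤ _ := by rw [CStarRing.norm_one]; gcongr
    linarith
  have hXn : ‖(X : 𝒜)‖ ≤ 3 / 2 := by
    rw [hXv]
    calc _ ≤ ‖(1 : 𝒜)‖ + ‖Complex.I • R‖ := norm_sub_le _ _
      _ ≤ _ := by rw [CStarRing.norm_one]; linarith
  have hs1 : star G * (2 - (X : 𝒜)) = 1 := by rw [← hsX, ← star_mul, hXG, star_one]
  have hs2 : (2 - (X : 𝒜)) * star G = 1 := by rw [← hsX, ← star_mul, hGX, star_one]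
  have hstar : star (2 * G - 1) = 2 * star G - 1 := by
    rw [star_sub, two_mul, two_mul, star_add, star_one]
  -- This is `X + star X = 2` multiplied by inverses on both sides; it is equivalent to unitarity of
  -- `2G - 1`.
  have e1 : G + star G = 2 * (G * star G) := by
    calc G + star G = G * ((2 - (X : 𝒜)) * star G) + (G * X) * star G := by rw [hs2, hGX]; simp
      _ = _ := by noncomm_ring
  have e2 : G + star G = 2 * (star G * G) := by
    calc G + star G = (star G * (2 - (X : 𝒜))) * G + star G * (X * G) := by rw [hs1, hXG]; simp
      _ = _ := by noncomm_ring
  have key : ∀ T : 𝒜, T * (2 * G - 1) - (2 * G - 1) * T =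
      (2 * Complex.I) • (G * (T * R - R * T) * G) := by
    intro T
    calc T * (2 * G - 1) - (2 * G - 1) * T
        = 2 * ((G * X) * (T * G) - G * T * (X * G)) := by rw [hGX, hXG]; noncomm_ring
      _ = 2 * (G * (X * T - T * X) * G) := by noncomm_ring
      _ = 2 * (G * (Complex.I • (T * R - R * T)) * G) := by
        congr 3
        rw [hXv, sub_mul, mul_sub, smul_mul_assoc, mul_smul_comm, smul_sub]; noncomm_ring
      _ = _ := by
        rw [mul_smul_comm, smul_mul_assoc, mul_smul, two_mul, two_smul]
  refine ⟨2 * G - 1, ?_, fun T => ⟨?_, ?_⟩⟩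
  · rw [Unitary.mem_iff, hstar]
    constructor
    · calc _ = 2 * (2 * (star G * G)) - 2 * (G + star G) + 1 := by noncomm_ring
        _ = 1 := by rw [e2]; abel
    · calc _ = 2 * (2 * (G * star G)) - 2 * (G + star G) + 1 := by noncomm_ring
        _ = 1 := by rw [e1]; abel
  · rw [key, norm_smul]
    calc _ = 2 * ‖G * (T * R - R * T) * G‖ := by simp
      _ ≤ 2 * (‖G‖ * ‖T * R - R * T‖ * ‖G‖) := by
        gcongr
        exact (norm_mul_le _ _).trans (by gcongr; exact norm_mul_le _ _)
      _ ≤ 2 * (2 * ‖T * R - R * T‖ * 2) := by gcongr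
      _ = _ := by ring
  · set W := T * (2 * G - 1) - (2 * G - 1) * T with hW
    have h3 : (2 * Complex.I) • (T * R - R * T) = X * W * X := by
      rw [hW, key, mul_smul_comm, smul_mul_assoc]
      congr 1
      calc T * R - R * T = (X * G) * (T * R - R * T) * (G * X) := by rw [hXG, hGX]; simp
        _ = _ := by noncomm_ring
    have h4 : 2 * ‖T * R - R * T‖ = ‖(X : 𝒜) * W * X‖ := by rw [← h3, norm_smul]; simp
    have h5 : ‖(X : 𝒜) * W * X‖ ≤ 3 / 2 * ‖W‖ * (3 / 2) := by
      calc _ ≤ ‖(X : 𝒜)‖ * ‖W‖ * ‖(X : 𝒜)‖ :=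
            (norm_mul_le _ _).trans (by gcongr; exact norm_mul_le _ _)
        _ ≤ _ := by gcongr
    nlinarith [norm_nonneg W]

end Cayley

/-- Conjugation by a unitary commutes with `applyFun`. -/
theorem applyFun_conj {H : Type u} [NormedAddCommGroup H] [InnerProductSpace ℂ H] [CompleteSpace H]
    (f : ℝ → ℂ) {A : H →L[ℂ] H} (hA : IsSelfAdjoint A)
    (hf : ContinuousOn (fun z : ℂ => f z.re) (spectrum ℂ A)) (U : unitary (H →L[ℂ] H)) :
    applyFun f (Unitary.conjStarAlgAut ℂ _ U A) = Unitary.conjStarAlgAut ℂ _ U (applyFun f A) := by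
  unfold applyFun
  refine (StarAlgHomClass.map_cfc (S := ℂ) (Unitary.conjStarAlgAut ℂ (H →L[ℂ] H) U) _ A hf ?_
    hA.isStarNormal ?_).symm
  · change Continuous fun x : H →L[ℂ] H => (U : H →L[ℂ] H) * x * star (U : H →L[ℂ] H)
    fun_prop
  · exact (hA.map (Unitary.conjStarAlgAut ℂ (H →L[ℂ] H) U)).isStarNormal

/-- Commutators of `f(A)` with small self-adjoint operators are controlled by the operator modulus. -/
theorem norm_commutator_applyFun_le {H : Type u} [NormedAddCommGroup H] [InnerProductSpace ℂ H]
    [CompleteSpace H] [Nontrivial H] {E : Set ℝ} {f : ℝ → ℂ} (hf : ContinuousOn f E)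
    (hfin : operatorModulusOn.{u} E f 1 < ∞) {A R : H →L[ℂ] H} (hA : IsSelfAdjoint A)
    (hAE : spectrum ℂ A ⊆ Complex.ofReal '' E) (hR : IsSelfAdjoint R) (hn : ‖R‖ ≤ 1 / 2)
    (hc : ‖A * R - R * A‖ < 1 / 8) :
    ‖applyFun f A * R - R * applyFun f A‖ ≤ 2 * (operatorModulusOn.{u} E f 1).toReal := by
  obtain ⟨U, hU, hb⟩ := exists_unitary_commutator_bounds hR hn
  set V : unitary (H →L[ℂ] H) := ⟨U, hU⟩
  have hcont : ContinuousOn (fun z : ℂ => f z.re) (spectrum ℂ A) := by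
    refine hf.comp Complex.continuous_re.continuousOn fun z hz => ?_
    obtain ⟨x, hx, rfl⟩ := hAE hz
    simpa using hx
  have hdiff : ∀ T : H →L[ℂ] H, ‖T - Unitary.conjStarAlgAut ℂ _ V T‖ = ‖T * U - U * T‖ := by
    intro T
    have h : T - Unitary.conjStarAlgAut ℂ _ V T = (T * U - U * T) * (star V : unitary (H →L[ℂ] H)) := by
      rw [Unitary.conjStarAlgAut_apply, sub_mul]
      congr 1
      change T = T * U * star U
      rw [mul_assoc, (Unitary.mem_iff.1 hU).2, mul_one]
    rw [h, CStarRing.norm_mul_coe_unitary]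
  have hle : ENNReal.ofReal ‖applyFun f A - applyFun f (Unitary.conjStarAlgAut ℂ _ V A)‖ ≤
      operatorModulusOn.{u} E f 1 := by
    refine le_sSup ⟨H, _, _, _, A, Unitary.conjStarAlgAut ℂ _ V A, hA,
      hA.map (Unitary.conjStarAlgAut ℂ (H →L[ℂ] H) V), hAE, ?_, ?_, rfl⟩
    · rwa [AlgEquiv.spectrum_eq]
    -- The factor 8 of the Cayley bound turns `< 1 / 8` into `‖A - UAU*‖ < 1`.
    · rw [hdiff]
      linarith [(hb A).1]
  rw [applyFun_conj f hA hcont, hdiff] at hle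
  have := (ENNReal.ofReal_le_iff_le_toReal hfin.ne).1 hle
  linarith [(hb (applyFun f A)).2]

/-! ### Diagonal operators -/

/-- The functional calculus of a diagonal operator. -/
theorem applyFun_diagonal {ι : Type u} [Fintype ι] [DecidableEq ι] (f : ℝ → ℂ) (d : ι → ℝ) :
    applyFun f (Matrix.toEuclideanCLM (𝕜 := ℂ) (n := ι) (Matrix.diagonal fun i => (d i : ℂ))) =
      Matrix.toEuclideanCLM (𝕜 := ℂ) (n := ι) (Matrix.diagonal fun i => f (d i)) := by
  -- On the finite spectrum `f` agrees with an interpolating polynomial, which commutes with the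
  -- diagonal homomorphism.
  set p : Polynomial ℂ := Lagrange.interpolate (Finset.univ.image fun i => (d i : ℂ)) id
    fun z => f z.re
  have hp : ∀ i, p.eval (d i : ℂ) = f (d i) := by
    intro i
    have := Lagrange.eval_interpolate_at_node (s := Finset.univ.image fun i => (d i : ℂ)) (v := id)
      (i := (d i : ℂ)) (fun z : ℂ => f z.re) (fun _ _ _ _ h => h)
      (Finset.mem_image_of_mem _ (Finset.mem_univ i))
    simpa only [id, Complex.ofReal_re] using this
  have hsa : IsSelfAdjoint (Matrix.toEuclideanCLM (𝕜 := ℂ) (n := ι)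
      (Matrix.diagonal fun i => (d i : ℂ))) := by
    refine IsSelfAdjoint.map ?_ _
    rw [IsSelfAdjoint, Matrix.star_eq_conjTranspose, Matrix.diagonal_conjTranspose]
    congr 1; ext i; simp
  have := hsa.isStarNormal
  unfold applyFun
  let ψ : (ι → ℂ) →ₐ[ℂ] (EuclideanSpace ℂ ι →L[ℂ] EuclideanSpace ℂ ι) :=
    (Matrix.toEuclideanCLM (𝕜 := ℂ) (n := ι)).toAlgEquiv.toAlgHom.comp (Matrix.diagonalAlgHom ℂ)
  rw [cfc_congr (g := p.eval), cfc_polynomial p _ hsa.isStarNormal]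
  · change Polynomial.aeval (ψ fun i => (d i : ℂ)) p = ψ fun i => f (d i)
    rw [Polynomial.aeval_algHom_apply]
    congr 1
    ext i
    rw [← hp i, Polynomial.aeval_pi_apply]
    exact congrFun (Polynomial.coe_aeval_eq_eval _) p
  · intro z hz
    rw [AlgEquiv.spectrum_eq, spectrum_diagonal] at hz
    obtain ⟨i, rfl⟩ := hz
    simp [hp]

/-! ### Operator norm estimates for matrices -/

open scoped Matrix.Norms.L2Operator in
theorem Matrix.l2_opNorm_le_iff_sum_sq {m n : Type*} [Fintype m] [Fintype n] [DecidableEq n]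
    (A : Matrix m n ℂ) {c : ℝ} (hc : 0 ≤ c) :
    ‖A‖ ≤ c ↔ ∀ x : n → ℂ, ∑ i, ‖A.mulVec x i‖ ^ 2 ≤ c ^ 2 * ∑ j, ‖x j‖ ^ 2 := by
  have key : ∀ x : n → ℂ, ‖(WithLp.toLp 2 (A.mulVec x) : EuclideanSpace ℂ m)‖ ≤
      c * ‖(WithLp.toLp 2 x : EuclideanSpace ℂ n)‖ ↔
      ∑ i, ‖A.mulVec x i‖ ^ 2 ≤ c ^ 2 * ∑ j, ‖x j‖ ^ 2 := by
    intro x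
    rw [← sq_le_sq₀ (norm_nonneg _) (by positivity), mul_pow, EuclideanSpace.norm_sq_eq,
      EuclideanSpace.norm_sq_eq]
  constructor
  · intro h x
    rw [← key]
    exact (Matrix.l2_opNorm_mulVec A (WithLp.toLp 2 x)).trans (by gcongr)
  · intro h
    rw [Matrix.l2_opNorm_def]
    refine ContinuousLinearMap.opNorm_le_bound _ hc fun x => ?_
    exact (key x.ofLp).2 (h x.ofLp)

open scoped Matrix.Norms.L2Operator in
theorem Matrix.l2_opNorm_le_card_mul {n : Type*} [Fintype n] [DecidableEq n]
    (A : Matrix n n ℂ) {c : ℝ} (hc : 0 ≤ c) (h : ∀ i j, ‖A i j‖ ≤ c) :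
    ‖A‖ ≤ Fintype.card n * c := by
  rw [Matrix.l2_opNorm_le_iff_sum_sq A (by positivity)]
  intro x
  have : ∀ i, ‖A.mulVec x i‖ ^ 2 ≤ c ^ 2 * (Fintype.card n * ∑ j, ‖x j‖ ^ 2) := by
    intro i
    have h1 : ‖A.mulVec x i‖ ≤ c * ∑ j, ‖x j‖ := by
      rw [Finset.mul_sum]
      refine (norm_sum_le _ _).trans (Finset.sum_le_sum fun j _ => ?_)
      rw [norm_mul]
      gcongr
      exact h i j
    calc _ ≤ (c * ∑ j, ‖x j‖) ^ 2 := by gcongr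
      _ = c ^ 2 * (∑ j, ‖x j‖) ^ 2 := by ring
      _ ≤ _ := by
        gcongr
        exact sq_sum_le_card_mul_sum_sq
  calc _ ≤ ∑ _i : n, c ^ 2 * (Fintype.card n * ∑ j, ‖x j‖ ^ 2) := Finset.sum_le_sum fun i _ => this i
    _ = _ := by rw [Finset.sum_const, Finset.card_univ, nsmul_eq_mul]; ring

open scoped Matrix.Norms.L2Operator in
theorem Matrix.norm_sum_entries_le {n : Type*} [Fintype n] [DecidableEq n] (A : Matrix n n ℂ) :
    ‖∑ i, ∑ j, A i j‖ ≤ Fintype.card n * ‖A‖ := by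
  have h := (Matrix.l2_opNorm_le_iff_sum_sq A (norm_nonneg _)).1 le_rfl fun _ => 1
  simp only [Matrix.mulVec, dotProduct, mul_one, norm_one, one_pow, Finset.sum_const,
    Finset.card_univ, nsmul_eq_mul] at h
  refine le_of_sq_le_sq ?_ (by positivity)
  calc _ ≤ (∑ i, ‖∑ j, A i j‖) ^ 2 := by gcongr; exact norm_sum_le _ _
    _ ≤ Fintype.card n * ∑ i, ‖∑ j, A i j‖ ^ 2 := sq_sum_le_card_mul_sum_sq
    _ ≤ Fintype.card n * (‖A‖ ^ 2 * Fintype.card n) := by gcongr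
    _ = _ := by ring

open scoped Matrix.Norms.L2Operator in
theorem Matrix.l2_opNorm_fromBlocks_offDiag_le {n : Type*} [Fintype n] [DecidableEq n]
    {M N : Matrix n n ℂ} {c : ℝ} (hM : ‖M‖ ≤ c) (hN : ‖N‖ ≤ c) :
    ‖Matrix.fromBlocks 0 M N 0‖ ≤ c := by
  have hc : 0 ≤ c := (norm_nonneg _).trans hM
  rw [Matrix.l2_opNorm_le_iff_sum_sq _ hc] at *
  intro x
  have h1 := hM (x ∘ Sum.inr)
  have h2 := hN (x ∘ Sum.inl)
  simp only [Matrix.fromBlocks_mulVec, Matrix.zero_mulVec, zero_add, add_zero,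
    Fintype.sum_sum_type, Sum.elim_inl, Sum.elim_inr, Function.comp_apply] at *
  linarith

open scoped Matrix.Norms.L2Operator in
theorem Matrix.le_l2_opNorm_fromBlocks_offDiag {n : Type*} [Fintype n] [DecidableEq n]
    (M N : Matrix n n ℂ) : ‖M‖ ≤ ‖Matrix.fromBlocks 0 M N 0‖ := by
  rw [Matrix.l2_opNorm_le_iff_sum_sq _ (norm_nonneg _)]
  intro x
  have h := (Matrix.l2_opNorm_le_iff_sum_sq (Matrix.fromBlocks 0 M N 0) (norm_nonneg _)).1 le_rfl
    (Sum.elim 0 x)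
  simpa [Matrix.fromBlocks_mulVec, Fintype.sum_sum_type] using h

/-! ### Failure of bounded triangular truncation -/

/-- Pythagoras: vectors of zero sum are orthogonal to constants. -/
theorem sum_norm_add_const_sq {ι : Type*} [Fintype ι] (y : ι → ℂ) (hy : ∑ i, y i = 0) (c : ℂ) :
    ∑ i, ‖y i + c‖ ^ 2 = ∑ i, ‖y i‖ ^ 2 + Fintype.card ι * ‖c‖ ^ 2 := by
  have h : ∀ i, ‖y i + c‖ ^ 2 = ‖y i‖ ^ 2 + ‖c‖ ^ 2 + 2 * (y i * (starRingEnd ℂ) c).re := by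
    intro i
    rw [← Complex.normSq_eq_norm_sq, Complex.normSq_add, Complex.normSq_eq_norm_sq,
      Complex.normSq_eq_norm_sq]
  simp only [h, Finset.sum_add_distrib, ← Finset.mul_sum, ← Complex.re_sum, ← Finset.sum_mul, hy]
  simp

/-- Matrices of size `2 ^ k` with norm at most `√k` whose strictly lower triangular parts have entry
sum `k * 2 ^ k / 4`: triangular truncation is not uniformly bounded on matrices. -/
theorem exists_matrix_large_triangular_part (k : ℕ) :
    ∃ (ι : Type u) (_ : Fintype ι) (_ : DecidableEq ι) (r : ι → ℕ) (P : Matrix ι ι ℂ) (N : ℕ),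
      Fintype.card ι = 2 ^ k ∧ (∀ j, ∑ i, P i j = 0) ∧
      (∀ x : ι → ℂ, ∑ i, ‖P.mulVec x i‖ ^ 2 ≤ k * ∑ j, ‖x j‖ ^ 2) ∧ (∀ i, r i < N) ∧
      ∑ i, ∑ j, (if r j < r i then P i j else 0) = k * 2 ^ k / 4 := by
  induction k with
  | zero =>
    exact ⟨PUnit, inferInstance, inferInstance, fun _ => 0, 0, 1, by simp, by simp, by simp, by simp,
      by simp⟩
  | succ k ih =>
    obtain ⟨ι, _, _, r, P, N, hcard, hcol, hnorm, hN, hsum⟩ := ih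
    have hcard' : (Fintype.card ι : ℂ) = 2 ^ k := by rw [hcard]; push_cast; rfl
    set t : ℂ := 1 / 2 ^ (k + 1) with ht
    set J : Matrix ι ι ℂ := Matrix.of fun _ _ => t with hJ
    -- Two copies of `P` plus a rank-one matrix whose range, spanned by `(-1, 1)`, is orthogonal to
    -- that of `P ⊕ P` by the zero column sums. Hence the squared norm bound grows by only 1. The
    -- shift by `N` puts the block `J` strictly below the diagonal and `-J` above it.
    refine ⟨ι ⊕ ι, inferInstance, inferInstance, Sum.elim r (fun i => r i + N),
      Matrix.fromBlocks (P - J) (-J) J (P + J), N + N, ?_, ?_, ?_, ?_, ?_⟩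
    · rw [Fintype.card_sum, hcard]; ring
    · rintro (j | j) <;>
        simp [Fintype.sum_sum_type, hJ, Finset.sum_add_distrib, Finset.sum_sub_distrib, hcol]
    · intro x
      have hx : ∑ j, ‖x j‖ ^ 2 = ∑ j, ‖x (Sum.inl j)‖ ^ 2 + ∑ j, ‖x (Sum.inr j)‖ ^ 2 :=
        Fintype.sum_sum_type _
      set c : ℂ := t * ∑ j, x j with hc
      have hcs : c = t * ∑ j, x (Sum.inl j) + t * ∑ j, x (Sum.inr j) := by
        rw [hc, Fintype.sum_sum_type, mul_add]
      have hz : ∀ y : ι → ℂ, ∑ i, P.mulVec y i = 0 := by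
        intro y
        simp only [Matrix.mulVec, dotProduct]
        rw [Finset.sum_comm]
        simp [← Finset.sum_mul, hcol]
      have hJv : ∀ (y : ι → ℂ) (i : ι), J.mulVec y i = t * ∑ j, y j := by
        intro y i
        simp [Matrix.mulVec, dotProduct, hJ, Finset.mul_sum]
      have h1 := sum_norm_add_const_sq (P.mulVec (x ∘ Sum.inl)) (hz _) (-c)
      have h2 := sum_norm_add_const_sq (P.mulVec (x ∘ Sum.inr)) (hz _) c
      have h3 := hnorm (x ∘ Sum.inl)
      have h4 := hnorm (x ∘ Sum.inr)
      have h5 : (2 : ℝ) ^ (k + 1) * ‖c‖ ^ 2 ≤ ∑ j, ‖x j‖ ^ 2 := by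
        have h6 : ‖∑ j, x j‖ ^ 2 ≤ 2 ^ (k + 1) * ∑ j, ‖x j‖ ^ 2 := by
          calc _ ≤ (∑ j, ‖x j‖) ^ 2 := by gcongr; exact norm_sum_le _ _
            _ ≤ (Fintype.card (ι ⊕ ι) : ℝ) * ∑ j, ‖x j‖ ^ 2 := sq_sum_le_card_mul_sum_sq
            _ = _ := by rw [Fintype.card_sum, hcard]; push_cast; ring
        have h7 : ‖t‖ = 1 / 2 ^ (k + 1) := by simp [ht]
        rw [hc, norm_mul, mul_pow, h7]
        have : (0 : ℝ) < 2 ^ (k + 1) := by positivity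
        calc _ = ‖∑ j, x j‖ ^ 2 / 2 ^ (k + 1) := by field_simp
          _ ≤ _ := by rw [div_le_iff₀ this]; linarith
      have h8 : ∑ i, ‖(Matrix.fromBlocks (P - J) (-J) J (P + J)).mulVec x i‖ ^ 2 =
          ∑ i, ‖P.mulVec (x ∘ Sum.inl) i + -c‖ ^ 2 + ∑ i, ‖P.mulVec (x ∘ Sum.inr) i + c‖ ^ 2 := by
        rw [Fintype.sum_sum_type]
        congr 1 <;> refine Finset.sum_congr rfl fun i _ => ?_ <;> congr 2
        · simp only [Matrix.fromBlocks_mulVec, Sum.elim_inl, Pi.add_apply, Matrix.sub_mulVec,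
            Matrix.neg_mulVec, Pi.sub_apply, Pi.neg_apply, hJv, hcs, Function.comp_apply]
          ring
        · simp only [Matrix.fromBlocks_mulVec, Sum.elim_inr, Pi.add_apply, Matrix.add_mulVec,
            hJv, hcs, Function.comp_apply]
          ring
      rw [h8, h1, h2, norm_neg, hcard]
      simp only [Function.comp_apply] at h3 h4
      push_cast
      rw [hx] at h5 ⊢
      rw [pow_succ] at h5
      linarith
    · rintro (i | i)
      · have := hN i; simp only [Sum.elim_inl]; omega
      · have := hN i; simp only [Sum.elim_inr]; omega
    -- The truncated `∓J` in the diagonal blocks cancel, so the sum doubles and gains `2 ^ k / 2`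
    -- from the lower left block.
    · have e5 : ∑ i : ι, ∑ j : ι, J i j = 2 ^ k / 2 := by
        simp only [hJ, Matrix.of_apply, Finset.sum_const, Finset.card_univ, nsmul_eq_mul, hcard', ht,
          pow_succ]
        field_simp
      generalize hQ : Matrix.fromBlocks (P - J) (-J) J (P + J) = Q
      generalize hr' : Sum.elim r (fun i => r i + N) = r'
      have b11 : ∀ i j, (if r' (Sum.inl j) < r' (Sum.inl i) then Q (Sum.inl i) (Sum.inl j) else 0) =
          (if r j < r i then P i j else 0) - (if r j < r i then J i j else 0) := by
        intro i j; subst hQ hr'; by_cases h : r j < r i <;> simp [h]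
      have b12 : ∀ i j, (if r' (Sum.inr j) < r' (Sum.inl i) then Q (Sum.inl i) (Sum.inr j) else 0) =
          0 := by
        intro i j
        have : ¬ (r j + N < r i) := by have := hN i; omega
        subst hr'
        simp [this]
      have b21 : ∀ i j, (if r' (Sum.inl j) < r' (Sum.inr i) then Q (Sum.inr i) (Sum.inl j) else 0) =
          J i j := by
        intro i j
        have : r j < r i + N := by have := hN j; omega
        subst hQ hr'
        simp [this]
      have b22 : ∀ i j, (if r' (Sum.inr j) < r' (Sum.inr i) then Q (Sum.inr i) (Sum.inr j) else 0) =
          (if r j < r i then P i j else 0) + (if r j < r i then J i j else 0) := by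
        intro i j; subst hQ hr'; by_cases h : r j < r i <;> simp [h]
      simp only [Fintype.sum_sum_type, b11, b12, b21, b22, Finset.sum_const_zero,
        Finset.sum_add_distrib, Finset.sum_sub_distrib, hsum, e5]
      push_cast
      ring

/-! ### Divided differences near infinity -/

/-- The difference equals `(t₀ f(t)/t - f(t₀)) / (t - t₀)`, whose numerator stays bounded. -/
theorem eventually_dividedDiff_close {E : Set ℝ} {f : ℝ → ℂ} {B : ℝ}
    (hB : ∀ᶠ t in comap (fun t : ℝ => |t|) atTop ⊓ 𝓟 E, ‖f t / (t : ℂ)‖ ≤ B)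
    (t₀ L : ℝ) {ε : ℝ} (hε : 0 < ε) :
    ∀ᶠ t in comap (fun t : ℝ => |t|) atTop ⊓ 𝓟 E,
      L ≤ |t - t₀| ∧ ‖(f t - f t₀) / ((t - t₀ : ℝ) : ℂ) - f t / (t : ℂ)‖ < ε := by
  set C : ℝ := |t₀| * |B| + ‖f t₀‖ + 1
  have hlarge : ∀ᶠ t in comap (fun t : ℝ => |t|) atTop ⊓ 𝓟 E, |t₀| + |L| + C / ε + 1 ≤ |t| :=
    (tendsto_comap.eventually_ge_atTop _).filter_mono inf_le_left
  filter_upwards [hB, hlarge] with t hBt ht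
  have hC : 0 < C := by positivity
  have hCe : 0 < C / ε := by positivity
  have h1 : |L| + C / ε < |t - t₀| := by
    have := abs_sub_abs_le_abs_sub t t₀
    linarith
  refine ⟨by linarith [le_abs_self L], ?_⟩
  have hpos : 0 < |t - t₀| := by linarith [abs_nonneg L]
  have ht0 : (t : ℂ) ≠ 0 := by
    have : 0 < |t| := by linarith [abs_nonneg L, abs_nonneg t₀]
    exact_mod_cast abs_pos.1 this
  have htt : (t : ℂ) - t₀ ≠ 0 := by exact_mod_cast abs_pos.1 hpos
  have heq : (f t - f t₀) / ((t - t₀ : ℝ) : ℂ) - f t / (t : ℂ) =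
      (t₀ * (f t / t) - f t₀) / ((t - t₀ : ℝ) : ℂ) := by
    push_cast
    field_simp
    ring
  rw [heq, norm_div, Complex.norm_real, Real.norm_eq_abs, div_lt_iff₀ hpos]
  calc ‖(t₀ : ℂ) * (f t / t) - f t₀‖ ≤ |t₀| * ‖f t / t‖ + ‖f t₀‖ := by
        refine (norm_sub_le _ _).trans ?_
        rw [norm_mul, Complex.norm_real, Real.norm_eq_abs]
    _ ≤ |t₀| * |B| + ‖f t₀‖ := by gcongr; exact hBt.trans (le_abs_self B)
    _ < C := by simp [C]
    _ = ε * (C / ε) := by field_simp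
    _ ≤ ε * |t - t₀| := by gcongr; linarith [abs_nonneg L]

/-- Nodes are chosen in the order `a 0, b 0, a 1, b 1, …`, each so far out that its divided
differences with all earlier nodes of the other kind are governed by its own limit point: `α` for an
`a`, `β` for a `b`. The later node decides the value. -/
theorem exists_seq_pairs_dividedDiff {E : Set ℝ} {f : ℝ → ℂ} {B : ℝ}
    (hB : ∀ᶠ t in comap (fun t : ℝ => |t|) atTop ⊓ 𝓟 E, ‖f t / (t : ℂ)‖ ≤ B) {α β : ℂ}
    (hα : MapClusterPt α (comap (fun t : ℝ => |t|) atTop ⊓ 𝓟 E) fun t : ℝ => f t / (t : ℂ))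
    (hβ : MapClusterPt β (comap (fun t : ℝ => |t|) atTop ⊓ 𝓟 E) fun t : ℝ => f t / (t : ℂ))
    {ε : ℝ} (hε : 0 < ε) (L : ℝ) :
    ∃ a b : ℕ → ℝ, (∀ m, a m ∈ E) ∧ (∀ m, b m ∈ E) ∧ (∀ m n, L ≤ |a m - b n|) ∧
      ∀ m n, ‖(f (a m) - f (b n)) / ((a m - b n : ℝ) : ℂ) - (if n < m then α else β)‖ < ε := by
  have step : ∀ γ : ℂ,
      MapClusterPt γ (comap (fun t : ℝ => |t|) atTop ⊓ 𝓟 E) (fun t : ℝ => f t / (t : ℂ)) →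
      ∀ s : Finset ℝ, ∃ t ∈ E, ∀ t₀ ∈ s,
        L ≤ |t - t₀| ∧ ‖(f t - f t₀) / ((t - t₀ : ℝ) : ℂ) - γ‖ < ε := by
    intro γ hγ s
    have h1 : ∃ᶠ t in comap (fun t : ℝ => |t|) atTop ⊓ 𝓟 E, f t / (t : ℂ) ∈ Metric.ball γ (ε / 2) :=
      hγ.frequently (Metric.ball_mem_nhds γ (by positivity))
    have h2 : ∀ᶠ t in comap (fun t : ℝ => |t|) atTop ⊓ 𝓟 E, ∀ t₀ ∈ s, L ≤ |t - t₀| ∧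
        ‖(f t - f t₀) / ((t - t₀ : ℝ) : ℂ) - f t / (t : ℂ)‖ < ε / 2 :=
      (Filter.eventually_all_finset s).2 fun t₀ _ => eventually_dividedDiff_close hB t₀ L (half_pos hε)
    have h3 : ∀ᶠ t in comap (fun t : ℝ => |t|) atTop ⊓ 𝓟 E, t ∈ E :=
      mem_inf_of_right (mem_principal_self E)
    obtain ⟨t, ht1, ht2, ht3⟩ := (h1.and_eventually (h2.and h3)).exists
    refine ⟨t, ht3, fun t₀ h0 => ⟨(ht2 t₀ h0).1, ?_⟩⟩
    rw [mem_ball_iff_norm] at ht1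
    calc _ = ‖((f t - f t₀) / ((t - t₀ : ℝ) : ℂ) - f t / (t : ℂ)) + (f t / (t : ℂ) - γ)‖ := by
          congr 1; ring
      _ ≤ _ := norm_add_le _ _
      _ < ε := by linarith [(ht2 t₀ h0).2]
  obtain ⟨c, hc1, hc2⟩ := exists_seq_of_forall_finset_exists
    (fun p : ℝ × ℝ => p.1 ∈ E ∧ p.2 ∈ E ∧ L ≤ |p.2 - p.1| ∧
      ‖(f p.2 - f p.1) / ((p.2 - p.1 : ℝ) : ℂ) - β‖ < ε)
    (fun p q : ℝ × ℝ => (L ≤ |q.1 - p.2| ∧ ‖(f q.1 - f p.2) / ((q.1 - p.2 : ℝ) : ℂ) - α‖ < ε) ∧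
      (L ≤ |q.2 - p.1| ∧ ‖(f q.2 - f p.1) / ((q.2 - p.1 : ℝ) : ℂ) - β‖ < ε)) (by
      intro s _
      obtain ⟨a, ha, ha'⟩ := step α hα (s.image Prod.snd)
      obtain ⟨b, hb, hb'⟩ := step β hβ (insert a (s.image Prod.fst))
      refine ⟨(a, b), ⟨ha, hb, hb' a (Finset.mem_insert_self _ _)⟩, fun p hp => ⟨?_, ?_⟩⟩
      · exact ha' _ (Finset.mem_image_of_mem _ hp)
      · exact hb' _ (Finset.mem_insert_of_mem (Finset.mem_image_of_mem _ hp)))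
  have hsymm : ∀ s t : ℝ, (f s - f t) / ((s - t : ℝ) : ℂ) = (f t - f s) / ((t - s : ℝ) : ℂ) := by
    intro s t
    rw [← neg_sub (f t), ← neg_sub t s, Complex.ofReal_neg, neg_div_neg_eq]
  have hle : ∀ m n, m ≤ n → L ≤ |(c n).2 - (c m).1| ∧
      ‖(f (c n).2 - f (c m).1) / (((c n).2 - (c m).1 : ℝ) : ℂ) - β‖ < ε := by
    intro m n h
    rcases h.eq_or_lt with rfl | h
    · exact (hc1 _).2.2
    · exact (hc2 m n h).2
  refine ⟨fun m => (c m).1, fun n => (c n).2, fun m => (hc1 m).1, fun m => (hc1 m).2.1,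
    fun m n => ?_, fun m n => ?_⟩
  · rcases lt_or_ge n m with h | h
    · exact (hc2 n m h).1.1
    · rw [abs_sub_comm]; exact (hle m n h).1
  · split_ifs with h
    · exact (hc2 n m h).1.2
    · rw [hsymm]; exact (hle m n (not_lt.1 h)).2

/-! ### From commutators to Schur multipliers -/

open scoped Matrix.Norms.L2Operator in
/-- Schur multiplication of off-diagonal blocks by divided differences of `f` is controlled by the
operator modulus of continuity. -/
theorem norm_dividedDiff_schur_le {E : Set ℝ} {f : ℝ → ℂ} (hf : ContinuousOn f E)
    (hfin : operatorModulusOn.{u} E f 1 < ∞) {ι : Type u} [Fintype ι] [DecidableEq ι] [Nonempty ι]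
    {a b : ι → ℝ} (ha : ∀ i, a i ∈ E) (hb : ∀ i, b i ∈ E) {K : Matrix ι ι ℂ} (hK : ‖K‖ ≤ 1 / 2)
    (hM : ‖(Matrix.of fun i j => ((a i : ℂ) - b j) * K i j : Matrix ι ι ℂ)‖ < 1 / 8) :
    ‖(Matrix.of fun i j => (f (a i) - f (b j)) * K i j : Matrix ι ι ℂ)‖ ≤
      2 * (operatorModulusOn.{u} E f 1).toReal := by
  set d : ι ⊕ ι → ℝ := Sum.elim a b with hd
  set Φ := Matrix.toEuclideanCLM (𝕜 := ℂ) (n := ι ⊕ ι) with hΦ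
  set R : Matrix (ι ⊕ ι) (ι ⊕ ι) ℂ := Matrix.fromBlocks 0 K K.conjTranspose 0 with hRdef
  have hnorm : ∀ X : Matrix (ι ⊕ ι) (ι ⊕ ι) ℂ, ‖Φ X‖ = ‖X‖ := fun X => rfl
  have hcomm : ∀ g : ι ⊕ ι → ℂ, Matrix.diagonal g * R - R * Matrix.diagonal g =
      Matrix.fromBlocks 0 (Matrix.of fun i j => (g (Sum.inl i) - g (Sum.inr j)) * K i j)
        (Matrix.of fun i j => (g (Sum.inr i) - g (Sum.inl j)) * star (K j i)) 0 := by
    intro g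
    ext (i | i) (j | j) <;>
      simp [hRdef, Matrix.diagonal_mul, Matrix.mul_diagonal, sub_mul, mul_comm (K _ _),
        mul_comm (starRingEnd ℂ _)]
  have hA : IsSelfAdjoint (Φ (Matrix.diagonal fun i => (d i : ℂ))) := by
    refine IsSelfAdjoint.map ?_ Φ
    rw [IsSelfAdjoint, Matrix.star_eq_conjTranspose, Matrix.diagonal_conjTranspose]
    congr 1; ext i; simp
  have hR : IsSelfAdjoint (Φ R) := by
    refine IsSelfAdjoint.map ?_ Φ
    rw [IsSelfAdjoint, Matrix.star_eq_conjTranspose, hRdef, Matrix.fromBlocks_conjTranspose]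
    simp
  have hspec : spectrum ℂ (Φ (Matrix.diagonal fun i => (d i : ℂ))) ⊆ Complex.ofReal '' E := by
    rw [AlgEquiv.spectrum_eq, spectrum_diagonal]
    rintro _ ⟨i | i, rfl⟩
    · exact ⟨a i, ha i, rfl⟩
    · exact ⟨b i, hb i, rfl⟩
  have hRn : ‖Φ R‖ ≤ 1 / 2 := by
    rw [hnorm]
    exact Matrix.l2_opNorm_fromBlocks_offDiag_le hK (by rwa [Matrix.l2_opNorm_conjTranspose])
  have hc : ‖Φ (Matrix.diagonal fun i => (d i : ℂ)) * Φ R -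
      Φ R * Φ (Matrix.diagonal fun i => (d i : ℂ))‖ < 1 / 8 := by
    rw [← map_mul, ← map_mul, ← map_sub, hnorm, hcomm]
    refine (Matrix.l2_opNorm_fromBlocks_offDiag_le le_rfl ?_).trans_lt hM
    -- The lower left block is minus the adjoint of the upper right one, as the nodes are real.
    rw [← Matrix.l2_opNorm_conjTranspose, ← norm_neg]
    refine le_of_eq (congrArg norm ?_)
    ext i j
    simp [hd]
    ring
  have := norm_commutator_applyFun_le hf hfin hA hspec hR hRn hc
  rw [applyFun_diagonal, ← map_mul, ← map_mul, ← map_sub, hnorm, hcomm] at this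
  exact (Matrix.le_l2_opNorm_fromBlocks_offDiag _ _).trans this

/-! ### Boundedness of `f(t)/t` and uniqueness of its limit points -/

open scoped Matrix.Norms.L2Operator in
/-- A function of finite operator modulus of continuity is Lipschitz in the large. -/
theorem norm_sub_le_of_operatorModulusOn_lt_top {E : Set ℝ} {f : ℝ → ℂ} (hf : ContinuousOn f E)
    (hfin : operatorModulusOn.{u} E f 1 < ∞) {s t : ℝ} (hs : s ∈ E) (ht : t ∈ E)
    (hst : 1 ≤ |s - t|) :
    ‖f s - f t‖ ≤ 32 * (operatorModulusOn.{u} E f 1).toReal * |s - t| := by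
  have hpos : 0 < |s - t| := by linarith
  have hne : (s : ℂ) - t ≠ 0 := by exact_mod_cast abs_pos.1 hpos
  have hn : ‖(s : ℂ) - t‖ = |s - t| := by rw [← Complex.ofReal_sub, Complex.norm_real, Real.norm_eq_abs]
  have hinv : |s - t|⁻¹ ≤ 1 := inv_le_one_of_one_le₀ hst
  -- The commutator entry becomes `1 / 16 < 1 / 8`; the final 32 is `2 * 16`.
  set K : Matrix PUnit.{u + 1} PUnit.{u + 1} ℂ := Matrix.of fun _ _ => 1 / 16 / ((s : ℂ) - t) with hK
  have hM := norm_dividedDiff_schur_le hf hfin (a := fun _ : PUnit.{u + 1} => s) (b := fun _ => t)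
    (fun _ => hs) (fun _ => ht) (K := K) ?_ ?_
  · have h1 := (Matrix.norm_sum_entries_le _).trans
      (mul_le_mul_of_nonneg_left hM (Nat.cast_nonneg (Fintype.card PUnit.{u + 1})))
    simp only [Finset.univ_unique, Finset.sum_singleton, Matrix.of_apply, hK, norm_mul, norm_div, hn,
      Fintype.card_unique, Nat.cast_one, one_mul] at h1
    have h2 : ‖f s - f t‖ / |s - t| ≤ 32 * (operatorModulusOn.{u} E f 1).toReal := by
      norm_num at h1
      rw [div_eq_mul_inv] at h1 ⊢
      linarith
    rwa [div_le_iff₀ hpos] at h2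
  · refine (Matrix.l2_opNorm_le_card_mul K (c := 1 / 2) (by norm_num) fun i j => ?_).trans (by simp)
    simp only [hK, Matrix.of_apply, norm_div, hn]
    norm_num
    rw [div_eq_mul_inv]
    linarith
  · refine (Matrix.l2_opNorm_le_card_mul _ (c := 1 / 16) (by norm_num) fun i j => ?_).trans_lt
      (by norm_num)
    simp only [hK, Matrix.of_apply]
    rw [mul_div_cancel₀ _ hne]
    norm_num

theorem eventually_norm_div_le {E : Set ℝ} {f : ℝ → ℂ} {C t₀ : ℝ} (hC : 0 ≤ C)
    (h : ∀ t ∈ E, 1 ≤ |t - t₀| → ‖f t - f t₀‖ ≤ C * |t - t₀|) :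
    ∀ᶠ t in comap (fun t : ℝ => |t|) atTop ⊓ 𝓟 E, ‖f t / (t : ℂ)‖ ≤ 2 * C + ‖f t₀‖ := by
  have hlarge : ∀ᶠ t in comap (fun t : ℝ => |t|) atTop ⊓ 𝓟 E, |t₀| + 1 ≤ |t| :=
    (tendsto_comap.eventually_ge_atTop _).filter_mono inf_le_left
  have hE : ∀ᶠ t in comap (fun t : ℝ => |t|) atTop ⊓ 𝓟 E, t ∈ E :=
    mem_inf_of_right (mem_principal_self E)
  filter_upwards [hlarge, hE] with t ht htE
  have h1 := abs_sub_abs_le_abs_sub t t₀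
  have h2 : |t - t₀| ≤ |t| + |t₀| := abs_sub t t₀
  have h3 := h t htE (by linarith)
  have h4 : 1 ≤ |t| := by linarith [abs_nonneg t₀]
  rw [norm_div, Complex.norm_real, Real.norm_eq_abs, div_le_iff₀ (by linarith)]
  calc ‖f t‖ = ‖(f t - f t₀) + f t₀‖ := by rw [sub_add_cancel]
    _ ≤ C * |t - t₀| + ‖f t₀‖ * 1 := by rw [mul_one]; exact (norm_add_le _ _).trans (by gcongr)
    _ ≤ C * (2 * |t|) + ‖f t₀‖ * |t| := by gcongr; linarith
    _ = _ := by ring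

open scoped Matrix.Norms.L2Operator in
/-- Two distinct limit points of `f t / t` at infinity would make triangular truncation bounded. -/
theorem mapClusterPt_div_unique {E : Set ℝ} {f : ℝ → ℂ} (hf : ContinuousOn f E)
    (hfin : operatorModulusOn.{u} E f 1 < ∞) {B : ℝ}
    (hB : ∀ᶠ t in comap (fun t : ℝ => |t|) atTop ⊓ 𝓟 E, ‖f t / (t : ℂ)‖ ≤ B) {α β : ℂ}
    (hα : MapClusterPt α (comap (fun t : ℝ => |t|) atTop ⊓ 𝓟 E) fun t : ℝ => f t / (t : ℂ))
    (hβ : MapClusterPt β (comap (fun t : ℝ => |t|) atTop ⊓ 𝓟 E) fun t : ℝ => f t / (t : ℂ)) :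
    α = β := by
  set Ω : ℝ := (operatorModulusOn.{u} E f 1).toReal with hΩ
  have hΩ0 : 0 ≤ Ω := ENNReal.toReal_nonneg
  -- Taking `k = q ^ 2` makes the norm bound `√k` equal to `q`, while the triangular sum is `q ^ 2 *
  -- n / 4`.
  have key : ∀ q : ℕ, 0 < q → ‖α - β‖ * (q : ℝ) ^ 2 / 4 ≤ 1 + 32 * q * Ω := by
    intro q hq
    have hq' : (0 : ℝ) < q := by exact_mod_cast hq
    obtain ⟨ι, _, _, r, P, N, hcard, hcol, hnorm, -, hsum⟩ :=
      exists_matrix_large_triangular_part.{u} (q ^ 2)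
    have hcard1 : 1 ≤ Fintype.card ι := by rw [hcard]; exact Nat.one_le_two_pow
    have : Nonempty ι := Fintype.card_pos_iff.1 hcard1
    set n : ℝ := (Fintype.card ι : ℝ) with hn
    have hn1 : 1 ≤ n := by rw [hn]; exact_mod_cast hcard1
    have hcardC : (2 : ℂ) ^ (q ^ 2) = ((n : ℝ) : ℂ) := by rw [hn, hcard]; push_cast; rfl
    rw [hcardC] at hsum
    set S : ℝ := ∑ i, ∑ j, ‖P i j‖ with hS
    have hS0 : 0 ≤ S := by positivity
    have hPS : ∀ i j, ‖P i j‖ ≤ S := fun i j =>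
      (Finset.single_le_sum (f := fun j => ‖P i j‖) (fun _ _ => norm_nonneg _)
        (Finset.mem_univ j)).trans
      (Finset.single_le_sum (f := fun i => ∑ j, ‖P i j‖)
        (fun _ _ => Finset.sum_nonneg fun _ _ => norm_nonneg _) (Finset.mem_univ i))
    have hPn : ‖P‖ ≤ q := by
      rw [Matrix.l2_opNorm_le_iff_sum_sq P hq'.le]
      intro x
      simpa using hnorm x
    -- This `ε` keeps the total error against `P` at most 1; the separation forces `‖K‖ ≤ 1 / 2`.
    obtain ⟨a, b, ha, hb, hsep, hdd⟩ := exists_seq_pairs_dividedDiff hB hα hβ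
      (ε := 1 / (S + 1)) (by positivity) (n * (S + 1))
    have hL : 0 < n * (S + 1) := by positivity
    have hpos : ∀ m k, 0 < |a m - b k| := fun m k => hL.trans_le (hsep m k)
    have hne : ∀ m k, (a m : ℂ) - b k ≠ 0 := fun m k => by exact_mod_cast abs_pos.1 (hpos m k)
    -- Normalizes the commutator block `c • P` to norm at most `1 / 16`.
    set c : ℝ := 1 / (16 * q) with hc
    have hc0 : 0 < c := by positivity
    have hc1 : c ≤ 1 / 16 := by
      rw [hc]
      apply one_div_le_one_div_of_le (by norm_num)
      have : (1 : ℝ) ≤ q := by exact_mod_cast hq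
      linarith
    set D : ι → ι → ℂ := fun i j =>
      (f (a (r i)) - f (b (r j))) / ((a (r i) - b (r j) : ℝ) : ℂ) with hD
    set K : Matrix ι ι ℂ := Matrix.of fun i j => (c : ℂ) * P i j / ((a (r i) : ℂ) - b (r j)) with hK
    have hmain := norm_dividedDiff_schur_le hf hfin (a := fun i => a (r i)) (b := fun i => b (r i))
      (fun i => ha _) (fun i => hb _) (K := K) ?_ ?_
    · have h1 := (Matrix.norm_sum_entries_le _).trans
        (mul_le_mul_of_nonneg_left hmain (Nat.cast_nonneg (Fintype.card ι)))
      have h2 : ∑ i, ∑ j, (Matrix.of fun i j => (f (a (r i)) - f (b (r j))) * K i j :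
          Matrix ι ι ℂ) i j = c * ∑ i, ∑ j, D i j * P i j := by
        simp only [Finset.mul_sum]
        refine Finset.sum_congr rfl fun i _ => Finset.sum_congr rfl fun j _ => ?_
        simp only [Matrix.of_apply, hK, hD, Complex.ofReal_sub]
        ring
      rw [h2, norm_mul, Complex.norm_real, Real.norm_eq_abs, abs_of_pos hc0, ← hn, ← hΩ] at h1
      -- The entries of `P` sum to zero, so the constant multiplier `β` contributes nothing.
      have h3 : ∑ i, ∑ j, (if r j < r i then α else β) * P i j = (α - β) * ((q : ℂ) ^ 2 * n / 4) := by
        have e : ∀ i j, (if r j < r i then α else β) * P i j =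
            (α - β) * (if r j < r i then P i j else 0) + β * P i j := by
          intro i j; split_ifs <;> ring
        have hz : ∑ i, ∑ j, P i j = 0 := 
          Finset.sum_comm.trans (Finset.sum_eq_zero fun j _ => hcol j)
        simp only [e, Finset.sum_add_distrib, ← Finset.mul_sum, hz, hsum]
        push_cast
        ring
      have h4 : ‖∑ i, ∑ j, D i j * P i j - (α - β) * ((q : ℂ) ^ 2 * n / 4)‖ ≤ 1 := by
        rw [← h3, ← Finset.sum_sub_distrib]
        simp only [← Finset.sum_sub_distrib, ← sub_mul]
        calc _ ≤ ∑ i, ∑ j, 1 / (S + 1) * ‖P i j‖ := by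
              refine (norm_sum_le _ _).trans (Finset.sum_le_sum fun i _ => ?_)
              refine (norm_sum_le _ _).trans (Finset.sum_le_sum fun j _ => ?_)
              rw [norm_mul]
              gcongr
              exact (hdd _ _).le
          _ = S / (S + 1) := by simp only [← Finset.mul_sum, ← hS]; ring
          _ ≤ 1 := by rw [div_le_one (by positivity)]; linarith
      have h5 : ‖(α - β) * ((q : ℂ) ^ 2 * n / 4)‖ = ‖α - β‖ * q ^ 2 / 4 * n := by
        rw [norm_mul, norm_div, norm_mul, norm_pow, Complex.norm_real, Complex.norm_natCast,
          Real.norm_eq_abs, abs_of_pos (by linarith : 0 < n)]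
        norm_num
        ring
      have h6 : ‖α - β‖ * q ^ 2 / 4 * n ≤ 1 + ‖∑ i, ∑ j, D i j * P i j‖ := by
        rw [← h5]
        have := norm_sub_norm_le ((α - β) * ((q : ℂ) ^ 2 * n / 4)) (∑ i, ∑ j, D i j * P i j)
        rw [norm_sub_rev] at this
        linarith
      have h7 : ‖∑ i, ∑ j, D i j * P i j‖ ≤ 32 * q * Ω * n := by
        rw [hc, one_div, inv_mul_le_iff₀ (by positivity)] at h1
        linarith
      have h8 : ‖α - β‖ * q ^ 2 / 4 * n ≤ (1 + 32 * q * Ω) * n := by linarith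
      exact le_of_mul_le_mul_right h8 (by linarith)
    · refine (Matrix.l2_opNorm_le_card_mul K (c := 1 / 2 / n) (by positivity) fun i j => ?_).trans ?_
      · simp only [hK, Matrix.of_apply]
        rw [norm_div, norm_mul, Complex.norm_real, Real.norm_eq_abs, abs_of_pos hc0,
          ← Complex.ofReal_sub, Complex.norm_real, Real.norm_eq_abs, div_le_div_iff₀ (hpos _ _)
          (by linarith)]
        calc c * ‖P i j‖ * n ≤ 1 / 16 * S * n := by gcongr; exact hPS i j
          _ ≤ 1 / 2 * (n * (S + 1)) := by nlinarith
          _ ≤ _ := by gcongr; exact hsep _ _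
      · rw [← hn]
        exact le_of_eq (by field_simp)
    · have : (Matrix.of fun i j => ((a (r i) : ℂ) - b (r j)) * K i j : Matrix ι ι ℂ) =
          (c : ℂ) • P := by
        ext i j
        simp only [hK, Matrix.of_apply, Matrix.smul_apply, smul_eq_mul]
        rw [mul_div_cancel₀ _ (hne _ _)]
      rw [this, norm_smul, Complex.norm_real, Real.norm_eq_abs, abs_of_pos hc0]
      calc c * ‖P‖ ≤ c * q := by gcongr
        _ = 1 / 16 := by rw [hc]; field_simp
        _ < 1 / 8 := by norm_num
  -- The left side of `key` is quadratic in `q`, the right side linear.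
  by_contra hne
  have hpos : 0 < ‖α - β‖ := norm_pos_iff.2 (sub_ne_zero.2 hne)
  obtain ⟨q, hq⟩ := exists_nat_gt (4 * (1 + 32 * Ω) / ‖α - β‖)
  have hq0 : 0 < q := by
    have : (0 : ℝ) < q := lt_of_le_of_lt (by positivity) hq
    exact_mod_cast this
  have hq1 : (1 : ℝ) ≤ q := by exact_mod_cast hq0
  rw [div_lt_iff₀ hpos] at hq
  have h := key q hq0
  have : 4 * (1 + 32 * Ω) * q < q * ‖α - β‖ * q := by gcongr
  nlinarith

/-! ### Existence of the limit -/

theorem comap_abs_inf_principal_neBot {E : Set ℝ} (hE : ¬ Bornology.IsBounded E) :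
    (comap (fun t : ℝ => |t|) atTop ⊓ 𝓟 E).NeBot := by
  have : comap (fun t : ℝ => |t|) atTop = Bornology.cobounded ℝ := comap_norm_atTop
  rw [this, ← frequently_mem_iff_neBot]
  intro h
  exact hE (Bornology.isBounded_def.2 h)

theorem exists_tendsto_div_of_operatorModulusOn_lt_top {E : Set ℝ} {f : ℝ → ℂ}
    (hE : ¬ Bornology.IsBounded E) (hf : ContinuousOn f E)
    (hfin : operatorModulusOn.{u} E f 1 < ∞) :
    ∃ L : ℂ, Tendsto (fun t : ℝ => f t / (t : ℂ))
      (comap (fun t : ℝ => |t|) atTop ⊓ 𝓟 E) (𝓝 L) := by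
  have := comap_abs_inf_principal_neBot hE
  obtain ⟨t₀, ht₀⟩ : E.Nonempty := by
    by_contra h
    exact hE (by simp [Set.not_nonempty_iff_eq_empty.1 h])
  have hB := eventually_norm_div_le (f := f) (E := E) (t₀ := t₀)
    (C := 32 * (operatorModulusOn.{u} E f 1).toReal) (by positivity)
    fun t ht h => norm_sub_le_of_operatorModulusOn_lt_top hf hfin ht ht₀ h
  set B := 2 * (32 * (operatorModulusOn.{u} E f 1).toReal) + ‖f t₀‖
  have hmem : ∀ᶠ t in comap (fun t : ℝ => |t|) atTop ⊓ 𝓟 E,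
      f t / (t : ℂ) ∈ Metric.closedBall (0 : ℂ) B := by
    filter_upwards [hB] with t ht
    simpa using ht
  have hcompact : IsCompact (Metric.closedBall (0 : ℂ) B) := isCompact_closedBall _ _
  obtain ⟨L, -, hL⟩ := hcompact (f := map (fun t : ℝ => f t / (t : ℂ))
    (comap (fun t : ℝ => |t|) atTop ⊓ 𝓟 E)) (le_principal_iff.2 hmem)
  exact ⟨L, hcompact.le_nhds_of_unique_clusterPt hmem fun x _ hx =>
    mapClusterPt_div_unique hf hfin hB hx hL⟩

theorem operatorModulusOn_univ_le (f : ℝ → ℂ) (δ : ℝ) :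
    operatorModulusOn.{u} Set.univ f δ ≤ operatorModulus.{u} f δ := by
  refine sSup_le_sSup ?_
  rintro _ ⟨H, _, _, _, A, B, hA, hB, -, -, hAB, rfl⟩
  exact ⟨H, _, _, _, A, B, hA, hB, hAB, rfl⟩

theorem mainTheorem9 :
    (∀ f : ℝ → ℂ, Continuous f →
      (∀ δ : ℝ, 0 < δ → operatorModulus.{u} f δ < ∞) →
      ∃ L : ℂ, Tendsto (fun t : ℝ => f t / (t : ℂ)) (comap (fun t : ℝ => |t|) atTop) (𝓝 L)) ∧
    (∀ (E : Set ℝ) (f : ℝ → ℂ), IsClosed E → ¬ Bornology.IsBounded E → ContinuousOn f E →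
      (∀ δ : ℝ, 0 < δ → operatorModulusOn.{u} E f δ < ∞) →
      ∃ L : ℂ, Tendsto (fun t : ℝ => f t / (t : ℂ))
        (comap (fun t : ℝ => |t|) atTop ⊓ 𝓟 E) (𝓝 L)) := by
  refine ⟨fun f hf hfin => ?_, fun E f _ hE hf hfin =>
    exists_tendsto_div_of_operatorModulusOn_lt_top hE hf (hfin 1 one_pos)⟩
  have h := exists_tendsto_div_of_operatorModulusOn_lt_top.{u} (E := Set.univ)
    (NoncompactSpace.noncompact_univ (X := ℝ) |> fun h hb =>
      h (Metric.isCompact_of_isClosed_isBounded isClosed_univ hb)) hf.continuousOn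
    ((operatorModulusOn_univ_le f 1).trans_lt (hfin 1 one_pos))
  simpa using h
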